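/- A metric space $X$ is called a (generalized) Urysohn space if for every finite subspace $A\subseteq X$ and every one-point metric extension $A'=A\cup\{a\}$ of $A$, the inclusion $A\hookrightarrow X$ extends to an isometric embedding $A'\hookrightarrow X$. Let $\mathbb U$ be the complete separable Urysohn metric space, and let $\mathrm{Iso}(\mathbb U)$ be the group of all isometries of $\mathbb U$ onto itself with the topology of pointwise convergence on $\mathbb U$. (1) For every finite collection $g_1,\dots,g_n\in\mathrm{Iso}(\mathbb U)$ and every neighbourhood $V$ of the identity in $\mathrm{Iso}(\mathbb U)$ there are $h_1,\dots,h_n\in\mathrm{Iso}(\mathbb U)$ which generate a finite subgroup and satisfy $h_ig_i^{-1}\in V$ for $i=1,\dots,n$. (2) For every free group $F$, the set of periodic actions of $F$ on $\mathbb U$ by isometries (that is, of homomorphisms $F\to\mathrm{Iso}(\mathbb U)$ that factor through a finite group) is dense in $\mathrm{Hom}(F,\mathrm{Iso}(\mathbb U))$ with the topology of pointwise convergence on $F$. (3) Let $F_\infty$ be the free group of countably infinite rank, and give the set $\mathcal L(\mathrm{Iso}(\mathbb U))$ of all closed subgroups of $\mathrm{Iso}(\mathbb U)$ the quotient topology under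 the map $\mathrm{Hom}(F_\infty,\mathrm{Iso}(\mathbb U))\to\mathcal L(\mathrm{Iso}(\mathbb U))$, $\tau\mapsto\overline{\tau(F_\infty)}$. Then the set of finite subgroups is dense in $\mathcal L(\mathrm{Iso}(\mathbb U))$. (4) Let $G$ be a Polish topological group and let $e\colon G\to\mathrm{Iso}(\mathbb U)$ be an embedding of topological groups. Then $e(G)$ is closed in $\mathrm{Iso}(\mathbb U)$, and it is the limit in $\mathcal L(\mathrm{Iso}(\mathbb U))$ of a net of finite subgroups of $\mathrm{Iso}(\mathbb U)$. -/

import Mathlib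

open Set Filter Topology

universe u v w

/-- A (generalized) Urysohn metric space: for every finite subspace `A` of `X` and every metric
space `Y` consisting of an isometric copy `j '' A` of `A` and one further point `a`, the inclusion
of `A` in `X` extends to an isometric embedding of `Y` into `X`. -/
def IsUrysohn (X : Type u) [MetricSpace X] : Prop :=
  ∀ (A : Set X), A.Finite → ∀ (Y : Type u) [MetricSpace Y] (j : A → Y) (a : Y),
    Isometry j → (∀ y : Y, y = a ∨ y ∈ range j) →
      ∃ f : Y → X, Isometry f ∧ ∀ x : A, f (j x) = x

/-- The topology of pointwise convergence on the group `X ≃ᵢ X` of isometries of `X` onto itself: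
the topology induced from the product `X ^ X`. -/
instance isoTopology (X : Type u) [MetricSpace X] : TopologicalSpace (X ≃ᵢ X) :=
  TopologicalSpace.induced (fun g : X ≃ᵢ X => (g : X → X)) inferInstance

theorem iso_tendsto_iff {X : Type u} [MetricSpace X] {α : Type v} {l : Filter α}
    {f : α → (X ≃ᵢ X)} {g : X ≃ᵢ X} :
    Tendsto f l (𝓝 g) ↔ ∀ x : X, Tendsto (fun a => f a x) l (𝓝 (g x)) := by
  rw [nhds_induced, tendsto_comap_iff, tendsto_pi_nhds]
  rfl

instance iso_isTopologicalGroup (X : Type u) [MetricSpace X] :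
    IsTopologicalGroup (X ≃ᵢ X) where
  continuous_mul := by
    rw [continuous_iff_continuousAt]
    rintro ⟨g, h⟩
    refine iso_tendsto_iff.2 fun x => ?_
    have hg := iso_tendsto_iff.1 (continuous_fst.tendsto (g, h))
    have hh := iso_tendsto_iff.1 (continuous_snd.tendsto (g, h))
    have h1 := tendsto_iff_dist_tendsto_zero.1 (hg (h x))
    have h2 := tendsto_iff_dist_tendsto_zero.1 (hh x)
    rw [tendsto_iff_dist_tendsto_zero]
    refine squeeze_zero (fun _ => dist_nonneg) (fun p => ?_) (by simpa using h2.add h1)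
    calc dist ((p.1 * p.2) x) ((g * h) x)
        ≤ dist (p.1 (p.2 x)) (p.1 (h x)) + dist (p.1 (h x)) (g (h x)) := dist_triangle _ _ _
      _ = dist (p.2 x) (h x) + dist (p.1 (h x)) (g (h x)) := by rw [p.1.dist_eq]
  continuous_inv := by
    rw [continuous_iff_continuousAt]
    intro g
    refine iso_tendsto_iff.2 fun x => ?_
    have hg := iso_tendsto_iff.1 (tendsto_id (x := 𝓝 g))
    have h1 := tendsto_iff_dist_tendsto_zero.1 (hg (g⁻¹ x))
    rw [tendsto_iff_dist_tendsto_zero]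
    refine h1.congr fun p => ?_
    have h2 := p.dist_eq (p⁻¹ x) (g⁻¹ x)
    rw [IsometryEquiv.apply_inv_self] at h2
    rw [IsometryEquiv.apply_inv_self, ← h2, dist_comm]
    rfl

/-- The topology of pointwise convergence on the set of homomorphisms `F → G`.  For `G = X ≃ᵢ X`
the homomorphisms are the actions of `F` on `X` by isometries. -/
instance homTopology (F : Type v) (G : Type u) [Group F] [Group G] [TopologicalSpace G] :
    TopologicalSpace (F →* G) :=
  TopologicalSpace.induced (fun τ : F →* G => (τ : F → G)) inferInstance

/-- An action `τ` of `F` on `X` by isometries is periodic if it factors through an action of a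
finite group. -/
def IsPeriodicAction {F : Type v} {X : Type u} [Group F] [MetricSpace X]
    (τ : F →* (X ≃ᵢ X)) : Prop :=
  ∃ (K : Type v) (_ : Group K) (_ : Finite K) (π : F →* K) (σ : K →* (X ≃ᵢ X)), τ = σ.comp π

/-- The closed subgroup of `G` obtained as the closure of the image of a homomorphism. -/
def closedRange {F : Type v} {G : Type u} [Group F] [Group G] [TopologicalSpace G]
    [IsTopologicalGroup G] (τ : F →* G) : ClosedSubgroup G where
  toSubgroup := τ.range.topologicalClosure
  isClosed' := τ.range.isClosed_topologicalClosure

/-- The topology on the space of closed subgroups of `G` which is the quotient topology under the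
map sending a homomorphism from the free group of countably infinite rank to the closure of its
image. -/
instance closedSubgroupTopology (G : Type u) [Group G] [TopologicalSpace G]
    [IsTopologicalGroup G] : TopologicalSpace (ClosedSubgroup G) :=
  TopologicalSpace.coinduced (fun τ : FreeGroup ℕ →* G => closedRange τ) inferInstance

/-! All four statements rest on one approximation: given an action `φ` of a free group of finite
rank, a finite set `A` of points and `ε > 0`, some action through a finite group is `ε`-close to `φ`
on `A` at each generator.

By residual finiteness, choose a finite quotient `K` in which all short words survive. On `K × A`
let the distance of `(k, a)` and `(l, b)` be the infimum of `dist a (φ w b) + δ * w.norm` over the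
words `w` representing `k⁻¹ * l`. Left translations preserve it, and the penalty makes long
representatives useless, so near the identity it agrees with the true distances up to `2 * δ`. Glue
this space to the given points at distance `δ` and realize it in `U`
(`IsUrysohn.exists_action_near`). Adding one orbit at a time through Katetov functions and then
completing, the action of `K` extends to all of `U` (`IsInvariantFamily.exists_action`).

Density in the space of homomorphisms follows because only finitely many generators matter, and it
passes to closed subgroups through the quotient map. Polish subgroups are closed by a Baire category
argument. -/

/-! ### Katetov functions and finite extensions in a Urysohn space. -/

/-- A function satisfying Katetov's inequalities at `w` has, for the supremum metric, distance
`f w` to the distance function of the point `w`. -/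
theorem dist_dist_eq_of_katetov {Z : Type v} {P : Type w} [Fintype Z] [PseudoMetricSpace P]
    (p : Z → P) (f : Z → ℝ) (w : Z) (h₁ : ∀ z, dist (p w) (p z) ≤ f w + f z)
    (h₂ : ∀ z, f z ≤ f w + dist (p w) (p z)) :
    dist f (fun z => dist (p w) (p z)) = f w := by
  have h₀ : 0 ≤ f w := by
    have := h₁ w
    rw [dist_self] at this
    linarith
  refine le_antisymm ((dist_pi_le_iff h₀).2 fun z => ?_) ?_
  · rw [Real.dist_eq, abs_le]
    constructor <;> linarith [h₁ z, h₂ z]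
  · have := dist_le_pi_dist f (fun z => dist (p w) (p z)) w
    rwa [dist_self, Real.dist_0_eq_abs, abs_of_nonneg h₀] at this

theorem dist_dist_dist_eq {Z : Type v} {P : Type w} [Fintype Z] [PseudoMetricSpace P]
    (p : Z → P) (x : P) (w : Z) :
    dist (fun z => dist x (p z)) (fun z => dist (p w) (p z)) = dist x (p w) :=
  dist_dist_eq_of_katetov p _ w (fun _ => dist_triangle_left _ _ _)
    (fun _ => dist_triangle _ _ _)

namespace IsUrysohn

variable {U : Type u} [MetricSpace U]

/-- In a Urysohn space every Katetov function on a finite set of points is realized. -/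
theorem exists_dist_eq (hU : IsUrysohn U) {I : Type v} [Finite I] (p : I → U) (r : I → ℝ)
    (h₁ : ∀ i j, dist (p i) (p j) ≤ r i + r j) (h₂ : ∀ i j, r i ≤ r j + dist (p j) (p i)) :
    ∃ x, ∀ i, dist x (p i) = r i := by
  have hfin : (range p).Finite := finite_range p
  have := hfin.fintype
  choose s hs using fun x : range p => x.2
  -- `p` need not be injective, but the inequalities make `r` constant on its fibres.
  have hrs : ∀ i, r (s ⟨p i, mem_range_self i⟩) = r i := fun i => by
    have h := hs ⟨p i, mem_range_self i⟩
    have h' := h₂ i (s ⟨p i, mem_range_self i⟩)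
    have h'' := h₂ (s ⟨p i, mem_range_self i⟩) i
    rw [h, dist_self] at h' h''
    linarith
  let f : range p → ℝ := fun x => r (s x)
  let k : range p → range p → ℝ := fun x z => dist (x : U) z
  -- Kuratowski's embedding: points become their distance functions under the supremum metric, and
  -- `f` itself serves as the extra point.
  let Y := {g : range p → ℝ | g = f ∨ g ∈ range k}
  have hk : ∀ x y, dist (k x) (k y) = dist x y := fun x y =>
    dist_dist_dist_eq (fun z : range p => (z : U)) x y
  have hf : ∀ x, dist f (k x) = f x := fun x =>
    dist_dist_eq_of_katetov (fun z : range p => (z : U)) f x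
      (fun z => by simpa only [hs] using h₁ (s x) (s z))
      (fun z => by simpa only [hs] using h₂ (s z) (s x))
  obtain ⟨e, he, hej⟩ := hU (range p) hfin Y (fun x => ⟨k x, .inr ⟨x, rfl⟩⟩) ⟨f, .inl rfl⟩
    (Isometry.of_dist_eq hk) (by
      rintro ⟨g, rfl | ⟨x, rfl⟩⟩
      · exact .inl rfl
      · exact .inr ⟨x, rfl⟩)
  refine ⟨e ⟨f, .inl rfl⟩, fun i => ?_⟩
  rw [show p i = e ⟨k ⟨p i, mem_range_self i⟩, .inr ⟨_, rfl⟩⟩ from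
    (hej ⟨p i, mem_range_self i⟩).symm, he.dist_eq]
  exact (hf _).trans (hrs i)

/-- A finite metric extension of a finite subspace of a Urysohn space is realized. -/
theorem exists_extension (hU : IsUrysohn U) {E : Type*} [PseudoMetricSpace E] {I J : Type*}
    [Finite I] [Finite J] (p : I → U) (q : I → E) (hpq : ∀ i j, dist (p i) (p j) = dist (q i) (q j))
    (r : J → E) :
    ∃ t : J → U, (∀ a b, dist (t a) (t b) = dist (r a) (r b)) ∧
      ∀ a i, dist (t a) (p i) = dist (r a) (q i) := by
  classical
  have := Fintype.ofFinite J
  suffices h : ∀ s : Finset J, ∃ t : J → U,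
      (∀ a ∈ s, ∀ b ∈ s, dist (t a) (t b) = dist (r a) (r b)) ∧
        ∀ a ∈ s, ∀ i, dist (t a) (p i) = dist (r a) (q i) by
    simpa using h Finset.univ
  intro s
  induction s using Finset.induction_on with
  | empty =>
    -- The empty Katetov function yields a point of `U`, used as a default value.
    obtain ⟨x, -⟩ := hU.exists_dist_eq (fun i : Empty => i.elim) (fun i => i.elim)
      (fun i => i.elim) (fun i => i.elim)
    exact ⟨fun _ => x, by simp, by simp⟩
  | insert c s hc ih =>
    obtain ⟨t, ht₁, ht₂⟩ := ih
    have hd : ∀ i j : I ⊕ s, dist (Sum.elim p (fun a : s => t a) i) (Sum.elim p (fun a : s => t a) j)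
        = dist (Sum.elim q (fun a : s => r a) i) (Sum.elim q (fun a : s => r a) j) := by
      rintro (i | i) (j | j)
      · exact hpq i j
      · simpa only [dist_comm, Sum.elim_inl, Sum.elim_inr] using ht₂ j j.2 i
      · exact ht₂ i i.2 j
      · exact ht₁ i i.2 j j.2
    obtain ⟨x, hx⟩ := hU.exists_dist_eq (Sum.elim p (fun a : s => t a))
      (fun i => dist (r c) (Sum.elim q (fun a : s => r a) i))
      (fun i j => by rw [hd]; exact dist_triangle_left _ _ _)
      (fun i j => by rw [hd]; exact dist_triangle _ _ _)
    have hne : ∀ a ∈ s, a ≠ c := fun a ha h => hc (h ▸ ha)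
    refine ⟨Function.update t c x, ?_, ?_⟩
    · intro a ha b hb
      rcases Finset.mem_insert.1 ha with rfl | ha' <;> rcases Finset.mem_insert.1 hb with rfl | hb'
      · simp
      · simpa [Function.update_of_ne (hne b hb')] using hx (.inr ⟨b, hb'⟩)
      · simpa [Function.update_of_ne (hne a ha'), dist_comm] using hx (.inr ⟨a, ha'⟩)
      · simpa [Function.update_of_ne (hne a ha'), Function.update_of_ne (hne b hb')]
          using ht₁ a ha' b hb'
    · intro a ha i
      rcases Finset.mem_insert.1 ha with rfl | ha
      · simpa using hx (.inl i)
      · simpa [Function.update_of_ne (hne a ha)] using ht₂ a ha i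

end IsUrysohn

/-! ### Extending a finite group action to the whole space, orbit by orbit. -/

/-- A set of `K`-indexed families of points, thought of as orbits, on whose union the translations
by elements of `K` are isometric. -/
def IsInvariantFamily {U : Type u} [MetricSpace U] {K : Type v} [Group K] (S : Set (K → U)) : Prop :=
  ∀ y ∈ S, ∀ z ∈ S, ∀ k l m : K, dist (y (k * l)) (z (k * m)) = dist (y l) (z m)

section Orbits

variable {U : Type u} [MetricSpace U] {K : Type v} [Group K]

/-- The orbit of a given point can be added to a finite invariant family. -/
theorem IsInvariantFamily.exists_insert (hU : IsUrysohn U) [Finite K] {S : Set (K → U)}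
    (hS : IsInvariantFamily S) (hfin : S.Finite) (x : U) :
    ∃ z : K → U, z 1 = x ∧ IsInvariantFamily (insert z S) := by
  have := hfin.fintype
  have := Fintype.ofFinite K
  let y : S × K → U := fun i => i.1.1 i.2
  have hy : ∀ (a b : S) (k l m : K), dist (y (a, k * l)) (y (b, k * m)) = dist (y (a, l)) (y (b, m)) :=
    fun a b k l m => hS a a.2 b b.2 k l m
  have hy' : ∀ (a b : S) (k l m : K), dist (y (a, k⁻¹ * l)) (y (b, m)) =
      dist (y (a, l)) (y (b, k * m)) := fun a b k l m => by
    rw [← hy a b k, mul_inv_cancel_left]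
  let q : S × K → S × K → ℝ := fun i j => dist (y i) (y j)
  -- `r k` is the distance function that the translate of `x` by `k` must have: `dist (k x) y = dist
  -- x (k⁻¹ y)`.
  let r : K → S × K → ℝ := fun k i => dist x (y (i.1, k⁻¹ * i.2))
  have hqq : ∀ i j, dist (q i) (q j) = dist (y i) (y j) := fun i j => dist_dist_dist_eq y (y i) j
  have hr1 : r 1 = fun i => dist x (y i) := by
    funext i
    simp only [r, inv_one, one_mul]
  have hrq : ∀ k i, dist (r k) (q i) = dist x (y (i.1, k⁻¹ * i.2)) := fun k i => by
    refine dist_dist_eq_of_katetov y (r k) i (fun z => ?_) (fun z => ?_)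
    · rw [← hy i.1 z.1 k⁻¹ i.2 z.2]
      exact dist_triangle_left _ _ _
    · rw [← hy i.1 z.1 k⁻¹ i.2 z.2]
      exact dist_triangle _ _ _
  -- The supremum metric is invariant because translation permutes the index set `S × K`.
  have hrr : ∀ k l m, dist (r (k * l)) (r (k * m)) = dist (r l) (r m) := by
    have aux : ∀ k l m, dist (r (k * l)) (r (k * m)) ≤ dist (r l) (r m) := fun k l m => by
      refine (dist_pi_le_iff dist_nonneg).2 fun i => ?_
      have := dist_le_pi_dist (r l) (r m) (i.1, k⁻¹ * i.2)
      simpa only [r, mul_inv_rev, mul_assoc] using this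
    intro k l m
    refine le_antisymm (aux k l m) ?_
    simpa only [inv_mul_cancel_left] using aux k⁻¹ (k * l) (k * m)
  -- The index `none` puts `x` among the given points, represented by `r 1`; this forces `t 1 = x`.
  obtain ⟨t, ht₁, ht₂⟩ := hU.exists_extension (Option.elim · x y)
    (Option.elim · (r 1) q) (by
      rintro (_ | i) (_ | j)
      · exact (dist_self _).trans (dist_self _).symm
      · exact ((hrq 1 j).trans (by simp)).symm
      · simpa [dist_comm] using (hrq 1 i).symm
      · exact (hqq i j).symm) r
  have htx : t 1 = x := dist_eq_zero.1 ((ht₂ 1 none).trans (dist_self _))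
  have hty : ∀ k i, dist (t k) (y i) = dist x (y (i.1, k⁻¹ * i.2)) := fun k i =>
    (ht₂ k (some i)).trans (hrq k i)
  have htS : ∀ z ∈ S, ∀ k l m, dist (t (k * l)) (z (k * m)) = dist (t l) (z m) :=
    fun z hz k l m => by
      rw [show z (k * m) = y (⟨z, hz⟩, k * m) from rfl, show z m = y (⟨z, hz⟩, m) from rfl, hty, hty]
      simp [mul_assoc]
  refine ⟨t, htx, ?_⟩
  rintro a (rfl | ha) b (rfl | hb) k l m
  · rw [ht₁, ht₁, hrr]
  · exact htS b hb k l m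
  · rw [dist_comm, htS a ha k m l, dist_comm]
  · exact hS a ha b hb k l m

/-- A finite invariant family is part of an invariant family whose base points are dense. -/
theorem IsInvariantFamily.exists_dense (hU : IsUrysohn U) [TopologicalSpace.SeparableSpace U]
    [Finite K] {S : Set (K → U)} (hS : IsInvariantFamily S) (hfin : S.Finite) :
    ∃ T, S ⊆ T ∧ IsInvariantFamily T ∧ Dense ((fun y : K → U => y 1) '' T) := by
  have : Nonempty U :=
    (hU.exists_dist_eq (fun i : Empty => i.elim) (fun i => i.elim) (fun i => i.elim)
      (fun i => i.elim)).nonempty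
  let Q := {S : Set (K → U) // S.Finite ∧ IsInvariantFamily S}
  have hstep : ∀ (x : U) (S : Q), ∃ T : Q, S.1 ⊆ T.1 ∧ ∃ z ∈ T.1, z 1 = x := fun x S => by
    obtain ⟨z, hz, hT⟩ := S.2.2.exists_insert hU S.2.1 x
    exact ⟨⟨_, S.2.1.insert z, hT⟩, subset_insert _ _, z, mem_insert _ _, hz⟩
  choose f hf hz using hstep
  let T : ℕ → Q := fun n => Nat.rec ⟨S, hfin, hS⟩ (fun n => f (TopologicalSpace.denseSeq U n)) n
  have hmono : Monotone fun n => (T n).1 := monotone_nat_of_le_succ fun n => hf _ _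
  refine ⟨⋃ n, (T n).1, subset_iUnion (fun n => (T n).1) 0, ?_, ?_⟩
  · intro y hy z hz
    obtain ⟨i, hi⟩ := mem_iUnion.1 hy
    obtain ⟨j, hj⟩ := mem_iUnion.1 hz
    exact (T (max i j)).2.2 y (hmono (le_max_left i j) hi) z (hmono (le_max_right i j) hj)
  · refine (TopologicalSpace.denseRange_denseSeq U).mono ?_
    rintro _ ⟨n, rfl⟩
    obtain ⟨z, hz, hzx⟩ := hz (TopologicalSpace.denseSeq U n) (T n)
    exact ⟨z, mem_iUnion.2 ⟨n + 1, hz⟩, hzx⟩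

/-- A family of points of a complete space which matches a dense family isometrically is its image
under an isometry. -/
theorem exists_isometry_of_denseRange [CompleteSpace U] {J : Type*} (p q : J → U)
    (hp : DenseRange p) (h : ∀ i j, dist (q i) (q j) = dist (p i) (p j)) :
    ∃ f : U → U, Isometry f ∧ ∀ j, f (p j) = q j := by
  -- With the pseudometric pulled back along `p`, both `p` and `q` are isometries, so `q` extends
  -- along the dense map `p`.
  let _ : PseudoMetricSpace J := PseudoMetricSpace.induced p inferInstance
  have hpi : Isometry p := Isometry.of_dist_eq fun _ _ => rfl
  have hqi : Isometry q := Isometry.of_dist_eq h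
  have hd : IsDenseInducing p := ⟨hpi.isUniformInducing.isInducing, hp⟩
  have huc : UniformContinuous (hd.extend q) :=
    uniformContinuous_uniformly_extend hpi.isUniformInducing hp hqi.uniformContinuous
  have he : ∀ j, hd.extend q (p j) = q j := fun j => hd.extend_eq hqi.continuous j
  refine ⟨hd.extend q, Isometry.of_dist_eq fun x y => ?_, he⟩
  refine hp.induction_on₂ (p := fun x y => dist (hd.extend q x) (hd.extend q y) = dist x y)
    ?_ (fun i j => ?_) x y
  · exact isClosed_eq
      ((huc.continuous.comp continuous_fst).dist (huc.continuous.comp continuous_snd))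
      (continuous_fst.dist continuous_snd)
  · rw [he, he, h]

/-- Every finite invariant family is permuted by an action of the group on the whole space. -/
theorem IsInvariantFamily.exists_action (hU : IsUrysohn U) [CompleteSpace U]
    [TopologicalSpace.SeparableSpace U] [Finite K] {S : Set (K → U)} (hS : IsInvariantFamily S)
    (hfin : S.Finite) :
    ∃ σ : K →* (U ≃ᵢ U), ∀ y ∈ S, ∀ k l, σ k (y l) = y (k * l) := by
  obtain ⟨T, hST, hT, hd⟩ := hS.exists_dense hU hfin
  have hd' : DenseRange fun y : T => y.1 1 := by
    rwa [DenseRange, ← image_eq_range (fun y : K → U => y 1)]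
  choose f hf hfT using fun k : K =>
    exists_isometry_of_denseRange (fun y : T => y.1 1) (fun y : T => y.1 k) hd' fun i j => by
      simpa using hT i i.2 j j.2 k 1 1
  -- The two points have equal distances to every `f k x`, by density of the base points; taking `x
  -- = y l` shows that they coincide.
  have hfl : ∀ y ∈ T, ∀ k l, f k (y l) = y (k * l) := fun y hy k l => by
    have hcl : IsClosed {x | dist (f k (y l)) (f k x) = dist (y (k * l)) (f k x)} :=
      isClosed_eq (continuous_const.dist (hf k).continuous)
        (continuous_const.dist (hf k).continuous)
    have hall : ∀ x, dist (f k (y l)) (f k x) = dist (y (k * l)) (f k x) := fun x =>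
      hd'.induction_on x hcl fun z => by
        rw [(hf k).dist_eq, hfT]
        simpa using (hT y hy z.1 z.2 k l 1).symm
    exact (dist_eq_zero.1 (((hall (y l)).symm).trans (dist_self _))).symm
  have hmul : ∀ k l x, f k (f l x) = f (k * l) x := fun k l x => by
    refine congrFun (hd'.equalizer ((hf k).continuous.comp (hf l).continuous)
      (hf (k * l)).continuous ?_) x
    funext z
    simp only [Function.comp_apply, hfT, hfl z.1 z.2]
  have hone : ∀ x, f 1 x = x := fun x => by
    refine congrFun (hd'.equalizer (hf 1).continuous continuous_id ?_) x
    funext z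
    simp only [Function.comp_apply, hfT, id]
  refine ⟨{ toFun k := IsometryEquiv.mk' (f k) (f k⁻¹) (fun x => by rw [hmul]; simp [hone]) (hf k)
            map_one' := ?_
            map_mul' k l := ?_ }, fun y hy k l => hfl y (hST hy) k l⟩
  · ext x
    exact hone x
  · ext x
    exact (hmul k l x).symm

end Orbits

/-! ### Residual finiteness of free groups. -/

/-- A free group of finite rank has a finite quotient in which a given ball of words survives. -/
theorem FreeGroup.exists_finiteIndex_normal {α : Type v} [Finite α] [DecidableEq α] (M : ℕ) :
    ∃ N : Subgroup (FreeGroup α), N.Normal ∧ N.FiniteIndex ∧ ∀ w ∈ N, w.norm ≤ M → w = 1 := by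
  classical
  let B := {w : FreeGroup α // w.norm ≤ M}
  have := (List.finite_length_le (α × Bool) M).to_subtype
  have : Finite B :=
    Finite.of_injective (β := {L : List (α × Bool) | L.length ≤ M})
      (fun w : B => ⟨w.1.toWord, w.2⟩)
      (fun v w h => Subtype.ext (FreeGroup.toWord_injective (congrArg Subtype.val h)))
  have := Fintype.ofFinite B
  -- Left multiplication by a generator is a partial injection of the finite ball `B`, which extends
  -- to a permutation.
  let σ : α → Equiv.Perm B := fun a => Equiv.extendSubtype
    (p := fun x : B => (FreeGroup.of a * x.1).norm ≤ M)
    (q := fun x : B => ((FreeGroup.of a)⁻¹ * x.1).norm ≤ M)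
    { toFun x := ⟨⟨FreeGroup.of a * x.1.1, x.2⟩, by simpa using x.1.2⟩
      invFun x := ⟨⟨(FreeGroup.of a)⁻¹ * x.1.1, x.2⟩, by simpa using x.1.2⟩
      left_inv x := by simp
      right_inv x := by simp }
  have hσ : ∀ a (x : B), (FreeGroup.of a * x.1).norm ≤ M → (σ a x).1 = FreeGroup.of a * x.1 :=
    fun a x h => congrArg Subtype.val (Equiv.extendSubtype_apply_of_mem _ x h)
  obtain ⟨o, ho⟩ : ∃ o : B, o.1 = 1 := ⟨⟨1, by rw [FreeGroup.norm_one]; exact Nat.zero_le M⟩, rfl⟩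
  -- All suffixes of a word of length at most `M` stay in the ball, where the permutations are true
  -- multiplications.
  have key : ∀ L : List (α × Bool), L.length ≤ M →
      (FreeGroup.lift σ (FreeGroup.mk L) o).1 = FreeGroup.mk L := by
    intro L
    induction L with
    | nil => exact fun _ => ho
    | cons c L ih =>
      intro h
      specialize ih ((Nat.le_succ _).trans h)
      have hn : (FreeGroup.mk (c :: L)).norm ≤ M := FreeGroup.norm_mk_le.trans h
      obtain ⟨a, b⟩ := c
      have hcons : FreeGroup.mk ((a, b) :: L) = FreeGroup.mk [(a, b)] * FreeGroup.mk L := by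
        rw [FreeGroup.mul_mk]; rfl
      rw [hcons] at hn ⊢
      rw [_root_.map_mul, Equiv.Perm.mul_apply]
      generalize FreeGroup.lift σ (FreeGroup.mk L) o = x at ih
      rw [← ih] at hn ⊢
      cases b with
      | true =>
        change (FreeGroup.of a * x.1).norm ≤ M at hn
        change (FreeGroup.lift σ (FreeGroup.of a) x).1 = FreeGroup.of a * x.1
        rw [FreeGroup.lift_apply_of, hσ a x hn]
      | false =>
        change ((FreeGroup.of a)⁻¹ * x.1).norm ≤ M at hn
        change (FreeGroup.lift σ (FreeGroup.of a)⁻¹ x).1 = (FreeGroup.of a)⁻¹ * x.1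
        have hx : σ a ⟨_, hn⟩ = x := Subtype.ext <| by
          rw [hσ a, mul_inv_cancel_left]
          rw [mul_inv_cancel_left]
          exact x.2
        rw [_root_.map_inv, FreeGroup.lift_apply_of, Equiv.Perm.inv_eq_iff_eq.2 hx.symm]
  refine ⟨(FreeGroup.lift σ).ker, inferInstance, inferInstance, fun w hw hM => ?_⟩
  have h := key w.toWord hM
  rw [FreeGroup.mk_toWord, MonoidHom.mem_ker.1 hw, Equiv.Perm.one_apply, ho] at h
  exact h.symm

/-! ### Approximating an action by a finite one. -/

/-- The data of a finite group of isometries of a finite space whose metric agrees approximately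
with that of a set of points of a Urysohn space is realized by an action on that space. -/
theorem IsUrysohn.exists_action_near {U : Type u} [MetricSpace U] [CompleteSpace U]
    [TopologicalSpace.SeparableSpace U] (hU : IsUrysohn U) {K : Type v} [Group K] [Finite K]
    {A E Z : Type*} [Finite A] [Finite Z] [Nonempty Z] [PseudoMetricSpace E] (r : K × A → E)
    (hr : ∀ k l m a b, dist (r (k * l, a)) (r (k * m, b)) = dist (r (l, a)) (r (m, b)))
    (p : Z → U) (q : Z → K × A) {δ : ℝ} (hδ : 0 < δ)
    (h : ∀ i j, |dist (p i) (p j) - dist (r (q i)) (r (q j))| ≤ 2 * δ) :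
    ∃ (σ : K →* (U ≃ᵢ U)) (y : A → K → U), (∀ k l a, σ k (y a l) = y a (k * l)) ∧
      ∀ i, dist (y (q i).2 (q i).1) (p i) = δ := by
  -- Gluing requires a genuine metric, while `E` is only pseudometric.
  let Ψ : E → SeparationQuotient E := SeparationQuotient.mk
  have hΨ : ∀ x y, dist (Ψ x) (Ψ y) = dist x y := fun x y => SeparationQuotient.dist_mk x y
  let _ : MetricSpace (U ⊕ SeparationQuotient E) :=
    Metric.glueMetricApprox p (fun i => Ψ (r (q i))) δ hδ (by simpa only [hΨ] using h)
  obtain ⟨t, ht₁, ht₂⟩ := hU.exists_extension p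
    (fun i => (Sum.inl (p i) : U ⊕ SeparationQuotient E)) (fun i j => rfl)
    (fun x : K × A => (Sum.inr (Ψ (r x)) : U ⊕ SeparationQuotient E))
  have htt : ∀ x y, dist (t x) (t y) = dist (r x) (r y) := fun x y => (ht₁ x y).trans (hΨ _ _)
  let y : A → K → U := fun a k => t (k, a)
  have hS : IsInvariantFamily (range y) := by
    rintro _ ⟨a, rfl⟩ _ ⟨b, rfl⟩ k l m
    rw [htt, htt, hr]
  obtain ⟨σ, hσ⟩ := hS.exists_action hU (finite_range y)
  refine ⟨σ, y, fun k l a => hσ _ (mem_range_self a) k l, fun i => ?_⟩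
  rw [show y (q i).2 (q i).1 = t (q i) from rfl, ht₂, dist_comm]
  exact Metric.glueDist_glued_points p (fun i => Ψ (r (q i))) δ i

/-- An action of a free group of finite rank agrees approximately on the generators and on a finite
set of points with an action through a finite group. -/
theorem IsUrysohn.exists_finite_range_near {U : Type u} [MetricSpace U] [CompleteSpace U]
    [TopologicalSpace.SeparableSpace U] (hU : IsUrysohn U) {α : Type v} [Finite α]
    (φ : FreeGroup α →* (U ≃ᵢ U)) {A : Set U} (hA : A.Finite) {ε : ℝ} (hε : 0 < ε) :
    ∃ ψ : FreeGroup α →* (U ≃ᵢ U), Finite ψ.range ∧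
      ∀ i, ∀ x ∈ A, dist (ψ (.of i) x) (φ (.of i) x) ≤ ε := by
  classical
  -- Gluing needs at least one point, so the empty set is treated apart.
  obtain rfl | hne := A.eq_empty_or_nonempty
  · refine ⟨1, ?_, by simp⟩
    rw [MonoidHom.range_one]
    infer_instance
  have := hA.to_subtype
  have := hne.to_subtype
  have hδ : 0 < ε / 2 := half_pos hε
  generalize hδε : ε / 2 = δ at hδ
  let s : Option α → FreeGroup α := fun o => o.elim 1 FreeGroup.of
  have hs : ∀ o, (s o).norm ≤ 1 := by
    rintro (_ | i)
    · simp [s]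
    · simp [s]
  let p : Option α × A → U := fun i => φ (s i.1) i.2
  obtain ⟨C, hC⟩ := Metric.isBounded_iff.1 (finite_range p).isBounded
  -- A word of norm at least `M - 2` then has penalty at least `C`, which bounds all distances
  -- between the points `p i`.
  obtain ⟨M, hM⟩ := exists_nat_ge (C / δ + 2)
  rw [← le_sub_iff_add_le, div_le_iff₀ hδ] at hM
  obtain ⟨N, hN, hNfin, hNM⟩ := FreeGroup.exists_finiteIndex_normal (α := α) M
  have : Finite (FreeGroup α ⧸ N) := Subgroup.finite_quotient_of_finiteIndex
  let π := QuotientGroup.mk' N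
  have hπ : Function.Surjective π := QuotientGroup.mk'_surjective N
  let c : FreeGroup α → U → U → ℝ := fun w a b => dist a (φ w b) + δ * w.norm
  have hc : ∀ w a b, 0 ≤ c w a b := fun w a b => by positivity
  have hc_mul : ∀ v w x y z, c (v * w) x z ≤ c v x y + c w y z := fun v w x y z => by
    have h₁ : dist x (φ (v * w) z) ≤ dist x (φ v y) + dist y (φ w z) := by
      rw [← (φ v).dist_eq y, map_mul, IsometryEquiv.mul_apply]
      exact dist_triangle _ _ _
    have h₂ : ((v * w).norm : ℝ) ≤ v.norm + w.norm := mod_cast FreeGroup.norm_mul_le v w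
    have h₃ := mul_le_mul_of_nonneg_left h₂ hδ.le
    simp only [c]
    linarith
  have hc_inv : ∀ w x y, c w⁻¹ y x = c w x y := fun w x y => by
    simp only [c, FreeGroup.norm_inv_eq]
    rw [← (φ w).dist_eq y, ← IsometryEquiv.mul_apply, ← map_mul, mul_inv_cancel, map_one,
      IsometryEquiv.coe_one, id, dist_comm]
  let D : FreeGroup α ⧸ N → U → U → ℝ := fun k a b => ⨅ w : {w // π w = k}, c w a b
  have hne' : ∀ k, Nonempty {w // π w = k} := fun k => (hπ k).elim fun w hw => ⟨⟨w, hw⟩⟩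
  have hbdd : ∀ k a b, BddBelow (range fun w : {w // π w = k} => c w a b) := fun k a b =>
    ⟨0, forall_mem_range.2 fun w => hc _ _ _⟩
  have hD_le : ∀ w a b, D (π w) a b ≤ c w a b := fun w a b => ciInf_le (hbdd (π w) a b) ⟨w, rfl⟩
  have hD_tri : ∀ k l x y z, D (k * l) x z ≤ D k x y + D l y z := fun k l x y z => by
    refine le_ciInf_add_ciInf fun v w => ?_
    have := hD_le (v * w) x z
    rw [map_mul, v.2, w.2] at this
    exact this.trans (hc_mul _ _ _ _ _)
  have hD_inv : ∀ k x y, D k⁻¹ y x ≤ D k x y := fun k x y => by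
    refine le_ciInf fun w => ?_
    have := hD_le (w : FreeGroup α)⁻¹ y x
    rwa [map_inv, w.2, hc_inv] at this
  let _ : PseudoMetricSpace ((FreeGroup α ⧸ N) × A) :=
    { dist x y := D (x.1⁻¹ * y.1) x.2 y.2
      dist_self x := by
        refine le_antisymm ?_ (Real.iInf_nonneg fun w => hc _ _ _)
        rw [inv_mul_cancel, ← map_one π]
        exact (hD_le 1 _ _).trans (by simp [c])
      dist_comm x y := by
        refine le_antisymm ?_ ?_
        · simpa using hD_inv (y.1⁻¹ * x.1) y.2 x.2
        · simpa using hD_inv (x.1⁻¹ * y.1) x.2 y.2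
      dist_triangle x y z := by
        simpa [mul_assoc] using hD_tri (x.1⁻¹ * y.1) (y.1⁻¹ * z.1) x.2 y.2 z.2 }
  have hdist : ∀ x y : (FreeGroup α ⧸ N) × A, dist x y = D (x.1⁻¹ * y.1) x.2 y.2 := fun _ _ => rfl
  obtain ⟨σ, y, hσ, hy⟩ := hU.exists_action_near (fun x : (FreeGroup α ⧸ N) × A => x)
    (fun k l m a b => by simp only [hdist, mul_inv_rev, mul_assoc, inv_mul_cancel_left])
    p (fun i => (π (s i.1), i.2)) hδ (by
      intro i j
      have hv : ((s i.1)⁻¹ * s j.1).norm ≤ 2 :=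
        (FreeGroup.norm_mul_le _ _).trans (by
          rw [FreeGroup.norm_inv_eq]; exact add_le_add (hs _) (hs _))
      have hp : dist (p i) (p j) = dist (i.2 : U) (φ ((s i.1)⁻¹ * s j.1) j.2) := by
        rw [← (φ (s i.1)).dist_eq (i.2 : U), ← IsometryEquiv.mul_apply, ← map_mul,
          mul_inv_cancel_left]
      rw [hdist]
      simp only
      rw [← map_inv, ← map_mul]
      generalize (s i.1)⁻¹ * s j.1 = v at hv hp
      have hv' : (v.norm : ℝ) ≤ 2 := mod_cast hv
      rw [abs_sub_comm, abs_le]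
      constructor
      · have : dist (p i) (p j) ≤ D (π v) i.2 j.2 := by
          -- A representative `w ≠ v` differs from `v` by a nontrivial element of `N`, of norm above
          -- `M`; since `v` has norm at most 2, the penalty of `w` alone suffices.
          refine le_ciInf fun w => ?_
          by_cases hwv : (w : FreeGroup α) = v
          · rw [hwv, hp]
            exact le_add_of_nonneg_right (by positivity)
          · have hmem : v⁻¹ * w ∈ N := QuotientGroup.eq.1 w.2.symm
            have hlt : M < (v⁻¹ * (w : FreeGroup α)).norm := by
              by_contra! hle
              exact hwv (inv_mul_eq_one.1 (hNM _ hmem hle)).symm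
            have hle := hlt.le.trans (FreeGroup.norm_mul_le _ _)
            rw [FreeGroup.norm_inv_eq] at hle
            have hw : (M : ℝ) - 2 ≤ (w : FreeGroup α).norm := by
              have : (M : ℝ) ≤ v.norm + (w : FreeGroup α).norm := mod_cast hle
              linarith
            calc dist (p i) (p j) ≤ C := hC (mem_range_self i) (mem_range_self j)
              _ ≤ (M - 2) * δ := hM
              _ ≤ δ * (w : FreeGroup α).norm := by
                rw [mul_comm]; exact mul_le_mul_of_nonneg_left hw hδ.le
              _ ≤ c w i.2 j.2 := le_add_of_nonneg_left dist_nonneg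
        linarith
      · have := hD_le v i.2 j.2
        have := mul_le_mul_of_nonneg_left hv' hδ.le
        simp only [c, ← hp] at *
        linarith)
  refine ⟨σ.comp π, ?_, fun i x hx => ?_⟩
  · exact ((finite_range σ).subset (by
      rw [MonoidHom.coe_range, MonoidHom.coe_comp]
      exact range_comp_subset_range π σ)).to_subtype
  · have h₁ := hy (none, ⟨x, hx⟩)
    have h₂ := hy (some i, ⟨x, hx⟩)
    simp only [s, p, Option.elim, map_one, IsometryEquiv.coe_one, id] at h₁ h₂
    -- Two steps of length `δ`: from `x` to its glued copy, and from the translated copy to `φ (.of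
    -- i) x`.
    calc dist (σ (π (.of i)) x) (φ (.of i) x)
        ≤ dist (σ (π (.of i)) x) (σ (π (.of i)) (y ⟨x, hx⟩ 1)) +
          dist (σ (π (.of i)) (y ⟨x, hx⟩ 1)) (φ (.of i) x) := dist_triangle _ _ _
      _ = δ + δ := by rw [(σ _).dist_eq, dist_comm x, h₁, hσ, mul_one, h₂]
      _ = ε := by rw [← hδε, add_halves]
      _ ≤ ε := le_rfl

/-! ### Topology of the isometry group. -/

section Topology

variable {U : Type u} [MetricSpace U]

/-- The basic neighbourhoods of an isometry are given by finite sets of points and positive radii. -/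
theorem exists_finite_dist_le_of_mem_nhds {g : U ≃ᵢ U} {V : Set (U ≃ᵢ U)} (hV : V ∈ 𝓝 g) :
    ∃ A : Set U, A.Finite ∧ ∀ᶠ ε in 𝓝[>] (0 : ℝ), ∀ h : U ≃ᵢ U,
      (∀ x ∈ A, dist (h x) (g x) ≤ ε) → h ∈ V := by
  rw [nhds_induced, mem_comap] at hV
  obtain ⟨W, hW, hWV⟩ := hV
  rw [nhds_pi, Filter.mem_pi] at hW
  obtain ⟨A, hA, t, ht, htW⟩ := hW
  refine ⟨A, hA, ?_⟩
  have : ∀ᶠ ε in 𝓝[>] (0 : ℝ), ∀ x ∈ A, Metric.closedBall (g x) ε ⊆ t x := by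
    refine (eventually_all_finite hA).2 fun x _ => ?_
    obtain ⟨ε, hε, hεt⟩ := Metric.nhds_basis_closedBall.mem_iff.1 (ht x)
    filter_upwards [Ioc_mem_nhdsGT hε] with δ hδ
    exact (Metric.closedBall_subset_closedBall hδ.2).trans hεt
  filter_upwards [this] with ε hε h hh
  exact hWV (htW fun x hx => hε x hx (hh x hx))

instance isometryEquiv_t2Space : T2Space (U ≃ᵢ U) :=
  T2Space.of_injective_continuous (f := fun g : U ≃ᵢ U => (g : U → U)) DFunLike.coe_injective
    continuous_induced_dom

/-- The topology of pointwise convergence is induced by the values at a dense sequence. -/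
theorem isInducing_apply_of_denseRange {ι : Type*} {d : ι → U} (hd : DenseRange d) :
    IsInducing fun (g : U ≃ᵢ U) i => g (d i) := by
  have hc : Continuous fun (g : U ≃ᵢ U) i => g (d i) :=
    continuous_pi fun i => (continuous_apply (d i)).comp continuous_induced_dom
  refine isInducing_iff_nhds.2 fun g => le_antisymm (hc.tendsto g).le_comap ?_
  refine tendsto_id'.1 (iso_tendsto_iff.2 fun x => Metric.tendsto_nhds.2 fun ε hε => ?_)
  obtain ⟨i, hi⟩ := Metric.denseRange_iff.1 hd x (ε / 4) (by positivity)
  have h₁ : Tendsto (fun h : U ≃ᵢ U => h (d i)) (comap (fun (g : U ≃ᵢ U) i => g (d i))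
      (𝓝 fun i => g (d i))) (𝓝 (g (d i))) :=
    ((continuous_apply i).tendsto (fun j => g (d j))).comp
      (tendsto_comap (f := fun (g : U ≃ᵢ U) i => g (d i)))
  filter_upwards [Metric.tendsto_nhds.1 h₁ (ε / 4) (by positivity)] with h hh
  have h₂ := dist_triangle4 (h x) (h (d i)) (g (d i)) (g x)
  rw [h.dist_eq, g.dist_eq, dist_comm (d i)] at h₂
  simp only [id]
  linarith

instance isometryEquiv_secondCountable [TopologicalSpace.SeparableSpace U] :
    SecondCountableTopology (U ≃ᵢ U) := by
  cases isEmpty_or_nonempty U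
  · have : Subsingleton (U ≃ᵢ U) := ⟨fun g h => IsometryEquiv.ext fun x => isEmptyElim x⟩
    infer_instance
  · have := UniformSpace.secondCountable_of_separable U
    exact (isInducing_apply_of_denseRange
      (TopologicalSpace.denseRange_denseSeq U)).secondCountableTopology

end Topology

/-! ### Density of periodic actions. -/

/-- Homomorphisms from a free group depend continuously on the images of the generators. -/
theorem FreeGroupBasis.continuous_lift {X F G : Type*} [Group F] [Group G] [TopologicalSpace G]
    [IsTopologicalGroup G] (b : FreeGroupBasis X F) :
    Continuous (b.lift : (X → G) → (F →* G)) := by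
  have h : ∀ w : FreeGroup X, Continuous fun f : X → G => FreeGroup.lift f w := fun w => by
    induction w using FreeGroup.induction_on with
    | C1 => simpa using continuous_const
    | of x => simpa using continuous_apply x
    | inv_of x h => simpa only [_root_.map_inv] using h.fun_inv
    | mul v w hv hw => simpa only [_root_.map_mul] using hv.fun_mul hw
  exact continuous_induced_rng.2 (continuous_pi fun w => h (b.repr w))

theorem FreeGroupBasis.range_lift_le {X F G : Type*} [Group F] [Group G]
    (b : FreeGroupBasis X F) (f : X → G) : (b.lift f).range ≤ Subgroup.closure (range f) := by
  rintro _ ⟨w, rfl⟩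
  change FreeGroup.lift f (b.repr w) ∈ _
  rw [← FreeGroup.range_lift_eq_closure]
  exact ⟨_, rfl⟩

/-- The quotient by the kernel is used rather than the range, because the finite group must live in
the universe of `F`. -/
theorem isPeriodicAction_of_finite_range {F : Type v} {X : Type u} [Group F] [MetricSpace X]
    {τ : F →* (X ≃ᵢ X)} (h : Finite τ.range) : IsPeriodicAction τ :=
  ⟨F ⧸ τ.ker, inferInstance,
    Finite.of_equiv τ.range (QuotientGroup.quotientKerEquivRange τ).symm.toEquiv,
    QuotientGroup.mk' τ.ker, QuotientGroup.kerLift τ, rfl⟩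

theorem IsPeriodicAction.finite_range {F : Type v} {X : Type u} [Group F] [MetricSpace X]
    {τ : F →* (X ≃ᵢ X)} (h : IsPeriodicAction τ) : Finite τ.range := by
  obtain ⟨K, _, _, π, σ, rfl⟩ := h
  refine ((Set.finite_range σ).subset ?_).to_subtype
  rw [MonoidHom.coe_range, MonoidHom.coe_comp]
  exact range_comp_subset_range π σ

namespace IsUrysohn

variable {U : Type u} [MetricSpace U] [CompleteSpace U] [TopologicalSpace.SeparableSpace U]

/-- Finitely many isometries are simultaneously approximated by generators of a finite group. -/
theorem exists_finite_closure_mem (hU : IsUrysohn U) {α : Type v} [Finite α] (g : α → (U ≃ᵢ U))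
    {V : α → Set (U ≃ᵢ U)} (hV : ∀ i, V i ∈ 𝓝 (g i)) :
    ∃ h : α → (U ≃ᵢ U), Finite (Subgroup.closure (range h)) ∧ ∀ i, h i ∈ V i := by
  choose A hA hAV using fun i => exists_finite_dist_le_of_mem_nhds (hV i)
  obtain ⟨ε, hεV, hε⟩ := ((eventually_all.2 hAV).and self_mem_nhdsWithin).exists
  obtain ⟨ψ, hψ, hψA⟩ := hU.exists_finite_range_near (FreeGroup.lift g) (finite_iUnion hA) hε
  refine ⟨fun i => ψ (.of i), ?_, fun i => hεV i _ fun x hx => ?_⟩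
  · have hle : Subgroup.closure (range fun i => ψ (.of i)) ≤ ψ.range := by
      rw [Subgroup.closure_le]
      rintro _ ⟨i, rfl⟩
      exact ⟨_, rfl⟩
    exact Finite.of_injective _ (Subgroup.inclusion_injective hle)
  · simpa using hψA i x (mem_iUnion.2 ⟨i, hx⟩)

/-- A basic open set of the product restricts finitely many coordinates; the others can be set to
the identity. -/
theorem dense_finite_closure (hU : IsUrysohn U) (X : Type v) :
    Dense {f : X → (U ≃ᵢ U) | Finite (Subgroup.closure (range f))} := by
  classical
  refine fun f => mem_closure_iff_nhds.2 fun W hW => ?_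
  rw [nhds_pi, Filter.mem_pi] at hW
  obtain ⟨I, hI, t, ht, htW⟩ := hW
  have := hI.to_subtype
  obtain ⟨h, hfin, hh⟩ := hU.exists_finite_closure_mem (fun i : I => f i) fun i => ht i
  refine ⟨fun x => if hx : x ∈ I then h ⟨x, hx⟩ else 1, htW fun x hx => ?_, ?_⟩
  · simpa [hx] using hh ⟨x, hx⟩
  · refine Finite.of_injective _ (Subgroup.inclusion_injective (K := Subgroup.closure (range h)) ?_)
    rw [Subgroup.closure_le]
    rintro _ ⟨x, rfl⟩
    by_cases hx : x ∈ I
    · simpa [hx] using Subgroup.subset_closure (mem_range_self (f := h) ⟨x, hx⟩)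
    · simp [hx]

theorem dense_isPeriodicAction (hU : IsUrysohn U) (F : Type v) [Group F] [IsFreeGroup F] :
    Dense {τ : F →* (U ≃ᵢ U) | IsPeriodicAction τ} := by
  let b := IsFreeGroup.basis F
  refine (b.lift.surjective.denseRange.dense_image b.continuous_lift
    (hU.dense_finite_closure _)).mono ?_
  rintro _ ⟨f, hf, rfl⟩
  have : Finite (Subgroup.closure (range f)) := hf
  exact isPeriodicAction_of_finite_range
    (Finite.of_injective _ (Subgroup.inclusion_injective (b.range_lift_le f)))

end IsUrysohn

/-! ### The space of closed subgroups and closedness of Polish subgroups. -/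

section ClosedSubgroup

variable {G : Type u} [Group G] [TopologicalSpace G] [IsTopologicalGroup G]

/-- Every closed subgroup of a second countable group is topologically generated by a sequence. -/
theorem closedRange_surjective [SecondCountableTopology G] :
    Function.Surjective (closedRange : (FreeGroup ℕ →* G) → ClosedSubgroup G) := by
  intro H
  have := TopologicalSpace.Subtype.secondCountableTopology (H.toSubgroup : Set G)
  have : TopologicalSpace.SeparableSpace H.toSubgroup :=
    inferInstanceAs (TopologicalSpace.SeparableSpace (H.toSubgroup : Set G))
  let d : ℕ → H.toSubgroup := TopologicalSpace.denseSeq H.toSubgroup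
  refine ⟨FreeGroup.lift fun n => (d n : G), ClosedSubgroup.toSubgroup_injective ?_⟩
  refine le_antisymm (Subgroup.topologicalClosure_minimal _ ?_ H.isClosed') fun x hx => ?_
  · rw [FreeGroup.range_lift_eq_closure, Subgroup.closure_le]
    rintro _ ⟨n, rfl⟩
    exact (d n).2
  · have h := TopologicalSpace.denseRange_denseSeq H.toSubgroup ⟨x, hx⟩
    rw [closure_subtype] at h
    refine closure_mono ?_ h
    rintro _ ⟨_, ⟨n, rfl⟩, rfl⟩
    exact ⟨.of n, FreeGroup.lift_apply_of (f := fun n => (d n : G))⟩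

/-- A finite subgroup of a Hausdorff group is already closed, so taking the closure adds nothing. -/
theorem finite_closedRange [T2Space G] {F : Type v} [Group F] {τ : F →* G} (h : Finite τ.range) :
    Finite (closedRange τ).toSubgroup := by
  have hcl : IsClosed (τ.range : Set G) := (Set.toFinite _).isClosed
  exact Finite.of_injective _ (Subgroup.inclusion_injective
    (Subgroup.topologicalClosure_minimal _ le_rfl hcl))

theorem IsUrysohn.dense_finite_closedSubgroup {U : Type u} [MetricSpace U] [CompleteSpace U]
    [TopologicalSpace.SeparableSpace U] (hU : IsUrysohn U) :
    Dense {H : ClosedSubgroup (U ≃ᵢ U) | Finite H.toSubgroup} := by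
  refine (closedRange_surjective.denseRange.dense_image continuous_coinduced_rng
    (hU.dense_isPeriodicAction (FreeGroup ℕ))).mono ?_
  rintro _ ⟨τ, hτ, rfl⟩
  exact finite_closedRange hτ.finite_range

/-- A point in the closure of a set is the limit of a net in that set. -/
theorem exists_tendsto_of_mem_closure {X : Type u} [TopologicalSpace X] {s : Set X} {x : X}
    (hx : x ∈ closure s) :
    ∃ (ι : Type u) (_ : Preorder ι) (_ : IsDirectedOrder ι) (_ : Nonempty ι) (f : ι → X),
      (∀ i, f i ∈ s) ∧ Tendsto f atTop (𝓝 x) := by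
  choose f hf using fun V : {V : Set X // V ∈ 𝓝 x} => mem_closure_iff_nhds.1 hx V V.2
  -- The net is indexed by the neighbourhoods of `x` under reverse inclusion.
  refine ⟨{V : Set X // V ∈ 𝓝 x}ᵒᵈ, inferInstance, ⟨fun V W => ?_⟩,
    ⟨OrderDual.toDual ⟨univ, univ_mem⟩⟩, fun V => f (OrderDual.ofDual V), fun V => (hf _).2, ?_⟩
  · exact ⟨OrderDual.toDual ⟨V.ofDual.1 ∩ W.ofDual.1, inter_mem V.ofDual.2 W.ofDual.2⟩,
      inter_subset_left, inter_subset_right⟩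
  · refine fun V hV => mem_map.2 ?_
    filter_upwards [Ici_mem_atTop (OrderDual.toDual (⟨V, hV⟩ : {V : Set X // V ∈ 𝓝 x}))] with W hW
    exact hW (hf _).1

/-- The range of a topological embedding of a completely metrizable group in a Hausdorff group
is closed. -/
theorem MonoidHom.isClosed_range_of_isEmbedding [T2Space G] {H : Type w} [Group H]
    [TopologicalSpace H] [IsTopologicalGroup H] [TopologicalSpace.IsCompletelyMetrizableSpace H]
    (e : H →* G) (he : IsEmbedding e) : IsClosed (e.range : Set G) := by
  let _ := TopologicalSpace.upgradeIsCompletelyMetrizable H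
  -- `O n` consists of the points near which `e⁻¹` has oscillation at most `1 / (n + 1)`, for a
  -- complete metric on `H`.
  let O : ℕ → Set G := fun n => {p | ∃ W, IsOpen W ∧ p ∈ W ∧
    ∀ x y, e x ∈ W → e y ∈ W → dist x y < 1 / ((n : ℝ) + 1)}
  have hO : ∀ n, IsOpen (O n) := fun n => isOpen_iff_forall_mem_open.2 fun p ⟨W, hW, hp, h⟩ =>
    ⟨W, fun _ hq => ⟨W, hW, hq, h⟩, hW, hp⟩
  have heO : ∀ n x, e x ∈ O n := fun n x => by
    obtain ⟨W, hW, hWx⟩ := he.isInducing.isOpen_iff.1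
      (Metric.isOpen_ball (x := x) (ε := 1 / ((n : ℝ) + 1) / 2))
    refine ⟨W, hW, ?_, fun y z hy hz => ?_⟩
    · have : x ∈ e ⁻¹' W := hWx ▸ Metric.mem_ball_self (by positivity)
      exact this
    · have hy' : y ∈ e ⁻¹' W := hy
      have hz' : z ∈ e ⁻¹' W := hz
      rw [hWx, Metric.mem_ball] at hy' hz'
      linarith [dist_triangle_right y z x]
  -- the range is the intersection of its closure with the sets `O n`
  have hGδ : ∀ p ∈ closure (range e), (∀ n, p ∈ O n) → p ∈ range e := fun p hp hpO => by
    have : NeBot (comap e (𝓝 p)) := comap_neBot_iff_frequently.2 (mem_closure_iff_frequently.1 hp)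
    have hc : Cauchy (comap e (𝓝 p)) := by
      refine Metric.cauchy_iff.2 ⟨this, fun ε hε => ?_⟩
      obtain ⟨n, hn⟩ := exists_nat_one_div_lt hε
      obtain ⟨W, hW, hpW, h⟩ := hpO n
      exact ⟨e ⁻¹' W, preimage_mem_comap (hW.mem_nhds hpW), fun x hx y hy => (h x y hx hy).trans hn⟩
    obtain ⟨x, hx⟩ := CompleteSpace.complete hc
    exact ⟨x, tendsto_nhds_unique ((he.continuous.tendsto x).mono_left hx) tendsto_comap⟩
  refine isClosed_of_closure_subset fun x hx => ?_
  -- For `x` in the closure, first approximate `x⁻¹ * e v` by some `e y`, then `x * e y` by some `e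
  -- z`; thus `x⁻¹ * e z` is close to `e y`, which lies in the open set `O n`.
  have hdense : ∀ n, Dense (e ⁻¹' ((x⁻¹ * ·) ⁻¹' O n)) := fun n => by
    refine dense_iff_inter_open.2 fun V hV ⟨v, hv⟩ => ?_
    obtain ⟨W, hW, rfl⟩ := he.isInducing.isOpen_iff.1 hV
    have hxv : x⁻¹ * e v ∈ e.range.topologicalClosure :=
      mul_mem (inv_mem hx) (subset_closure ⟨v, rfl⟩)
    obtain ⟨_, hyW, y, rfl⟩ := mem_closure_iff.1 hxv _ (hW.preimage (continuous_const_mul x))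
      (by simpa using hv)
    have hxy : x * e y ∈ e.range.topologicalClosure := mul_mem hx (subset_closure ⟨y, rfl⟩)
    obtain ⟨_, ⟨hzW, hzO⟩, z, rfl⟩ := mem_closure_iff.1 hxy _
      (hW.inter ((hO n).preimage (continuous_const_mul x⁻¹))) ⟨hyW, by simpa using heO n y⟩
    exact ⟨z, hzW, hzO⟩
  -- Baire's theorem in `H` gives one `g` that works for all `n`, so `x⁻¹ * e g` lies in the range,
  -- and hence so does `x`.
  obtain ⟨g, hg⟩ := (dense_iInter_of_isOpen_nat
    (fun n => ((hO n).preimage (continuous_const_mul x⁻¹)).preimage he.continuous) hdense).nonempty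
  have hgx : x⁻¹ * e g ∈ e.range.topologicalClosure :=
    mul_mem (inv_mem hx) (subset_closure ⟨g, rfl⟩)
  obtain ⟨y, hy⟩ := hGδ (x⁻¹ * e g) hgx fun n => mem_iInter.1 hg n
  exact ⟨g * y⁻¹, by rw [map_mul, map_inv, hy]; group⟩

end ClosedSubgroup

theorem theorem4p6 (U : Type u) [MetricSpace U] [CompleteSpace U]
    [TopologicalSpace.SeparableSpace U] (hU : IsUrysohn U) :
    -- simultaneous approximation of finitely many isometries
    (∀ (n : ℕ) (g : Fin n → (U ≃ᵢ U)) (V : Set (U ≃ᵢ U)), V ∈ 𝓝 (1 : U ≃ᵢ U) →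
      ∃ h : Fin n → (U ≃ᵢ U),
        Finite (Subgroup.closure (range h)) ∧ ∀ i, h i * (g i)⁻¹ ∈ V) ∧
    -- density of the periodic actions of every free group
    (∀ (F : Type v) [Group F] [IsFreeGroup F],
      Dense {τ : F →* (U ≃ᵢ U) | IsPeriodicAction τ}) ∧
    -- density of the finite subgroups in the space of closed subgroups
    Dense {H : ClosedSubgroup (U ≃ᵢ U) | Finite H.toSubgroup} ∧
    -- every Polish subgroup is closed and is the limit of a net of finite subgroups
    (∀ (G : Type w) [Group G] [TopologicalSpace G] [IsTopologicalGroup G] [PolishSpace G]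
      (e : G →* (U ≃ᵢ U)), IsEmbedding e →
      ∃ H : ClosedSubgroup (U ≃ᵢ U), H.toSubgroup = e.range ∧
        ∃ (ι : Type u) (_ : Preorder ι) (_ : IsDirectedOrder ι) (_ : Nonempty ι)
          (S : ι → ClosedSubgroup (U ≃ᵢ U)),
          (∀ i, Finite (S i).toSubgroup) ∧ Tendsto S atTop (𝓝 H)) := by
  refine ⟨fun n g V hV => ?_, fun F _ _ => hU.dense_isPeriodicAction F,
    hU.dense_finite_closedSubgroup, fun G _ _ _ _ e he => ?_⟩
  · refine hU.exists_finite_closure_mem g (V := fun i => (· * (g i)⁻¹) ⁻¹' V) fun i => ?_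
    refine (continuous_mul_const (g i)⁻¹).continuousAt.preimage_mem_nhds ?_
    rwa [mul_inv_cancel]
  · exact ⟨⟨e.range, e.isClosed_range_of_isEmbedding he⟩, rfl,
      exists_tendsto_of_mem_closure (hU.dense_finite_closedSubgroup _)⟩
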